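/- Let $\mathscr T_2$ be the infinite binary tree, i.e. the set of finite words over $\{0,1\}$ ordered by $s\le t$ iff $s$ is an initial segment of $t$ (the root is the least element). Let $L=\mathcal O\mathscr T_2$ be the frame of upsets of $\mathscr T_2$ ordered by inclusion, and let $N(L)$ be the frame of nuclei of $L$ (maps $j:L\to L$ with $a\le j(a)$, $j(j(a))=j(a)$, $j(a\wedge b)=j(a)\wedge j(b)$, ordered pointwise). Let $X$ be the set of (proper) prime filters of $L$, ordered by inclusion and topologized by the basis of sets $\eta(a)\setminus\eta(b)$, $a,b\in L$, where $\eta(a)=\{x\in X\mid a\in x\}$. A closed set $F\subseteq X$ is nuclear if $\{x\in X\mid x\le y\text{ for some }y\in F\cap U\}$ is clopen for each clopen $U\subseteq X$. Let $Y$ be the set of points $y\in X$ such that $\{y\}$ is nuclear (the nuclear points), and let $\max X$ be the set of maximal points of $X$. Then the frame $N(L)$ is not spatial, i.e. it is not isomorphic to the frame of open sets of any topological space. Moreover, $\max X\cap Y=\varnothing$. -/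

import Mathlib

open TopologicalSpace

namespace NucleiFrame

universe u

/-- The infinite binary tree: its nodes are the finite binary words, the root being the empty
word, and the two children of a node `w` being `w` followed by one more letter. -/
@[ext]
structure BinaryTree : Type where
  word : List Bool

namespace BinaryTree

/-- The tree order: `s ≤ t` iff `s` lies on the path from the root to `t`, that is, iff the word
`s` is an initial segment of the word `t`. The root is the least element. -/
instance : PartialOrder BinaryTree where
  le s t := s.word <+: t.word
  le_refl s := List.prefix_refl s.word
  le_trans _ _ _ h k := List.IsPrefix.trans h k
  le_antisymm _ _ h k := BinaryTree.ext (h.eq_of_length (le_antisymm h.length_le k.length_le))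

end BinaryTree

/-- The frame `𝒪 S` of a poset `S`: the open sets of `S` with its Alexandroff topology, whose open
sets are the upsets of `S`; the order is inclusion. -/
abbrev UpsetFrame (S : Type u) [PartialOrder S] : Type u :=
  Opens (Topology.WithUpperSet S)

/-- A frame is spatial if it is isomorphic to the frame of open sets of a topological space.
(An order isomorphism of frames preserves all joins and meets.) -/
def IsSpatial (L : Type u) [Order.Frame L] : Prop :=
  ∃ (S : Type u) (_ : TopologicalSpace S), Nonempty (L ≃o Opens S)

/-- The spectrum `X_L` of a frame `L`: the set of (proper) prime filters of `L`. -/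
def Spectrum (L : Type u) [Order.Frame L] : Type u :=
  {x : Order.PFilter L // x.IsPrime}

namespace Spectrum

variable {L : Type u} [Order.Frame L]

/-- The spectrum is ordered by inclusion of prime filters. -/
instance : PartialOrder (Spectrum L) :=
  PartialOrder.lift (fun x : Spectrum L => (x.1 : Set L))
    (fun _ _ h => Subtype.ext (SetLike.coe_injective h))

/-- `η a` is the set of prime filters containing `a`. -/
def eta (a : L) : Set (Spectrum L) := {x | a ∈ x.1}

/-- The patch topology `π_L`, with basis the sets `η a \ η b` (a family closed under finite
intersections that contains the whole spectrum `η ⊤ \ η ⊥`). -/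
instance : TopologicalSpace (Spectrum L) :=
  TopologicalSpace.generateFrom {W | ∃ a b : L, W = eta a \ eta b}

/-- A closed subset `F` of the spectrum is nuclear if the downset of `F ∩ U` is clopen for each
clopen `U`. -/
def IsNuclear (F : Set (Spectrum L)) : Prop :=
  IsClosed F ∧ ∀ U : Set (Spectrum L), IsClopen U →
    IsClopen {x : Spectrum L | ∃ y ∈ F ∩ U, x ≤ y}

end Spectrum

/-- The set `Y_L` of nuclear points of the spectrum. -/
def nuclearPoints (L : Type u) [Order.Frame L] : Set (Spectrum L) :=
  {x | Spectrum.IsNuclear {x}}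

/-- The set `max X_L` of maximal points of the spectrum. -/
def maxPoints (L : Type u) [Order.Frame L] : Set (Spectrum L) :=
  {x | IsMax x}

end NucleiFrame

/-! Both claims need only that each nonzero element of `L` lies above two disjoint nonzero ones; in
the tree these come from the two children of a node. If `N(L)` were spatial, a meet-prime nucleus
`P` would lie above double negation, making `P ⊥` a regular meet-prime element; splitting its
complement forbids this. If a maximal point `y` were nuclear, its downset would be open and so
contain some `η c` with `c ∈ y`; then `y` would contain every nonzero element below `c`, including
two disjoint ones. -/

namespace NucleiFrame

universe v

section Spatial

variable {L : Type v} [Order.Frame L]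

/-- In a spatial frame every element other than `⊤` lies below a meet-prime element. -/
theorem IsSpatial.exists_infPrime_ge (h : IsSpatial L) {a : L} (ha : a ≠ ⊤) :
    ∃ p : L, InfPrime p ∧ a ≤ p := by
  obtain ⟨S, _, ⟨e⟩⟩ := h
  obtain ⟨s, hs⟩ : ∃ s, s ∉ e a := by
    by_contra! hall
    exact ha ((map_eq_top_iff e).1 (top_unique fun s _ => hall s))
  -- The largest open set missing `s`; such sets are meet-prime.
  let U : Opens S := ⟨(closure {s})ᶜ, isClosed_closure.isOpen_compl⟩
  have le_U (V : Opens S) : V ≤ U ↔ s ∉ V := by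
    have : V ≤ U ↔ Disjoint (V : Set S) (closure {s}) := Set.subset_compl_iff_disjoint_right
    rw [this, ← SetLike.mem_coe, ← Set.disjoint_singleton_right]
    exact ⟨fun h => h.mono_right subset_closure, fun h => h.closure_right V.isOpen⟩
  have le_symm (b : L) : b ≤ e.symm U ↔ s ∉ e b := by rw [e.le_symm_apply, le_U]
  refine ⟨e.symm U, ⟨fun hmax => ?_, fun b c hbc => ?_⟩, (le_symm a).2 hs⟩
  · exact (le_symm ⊤).1 (isMax_iff_eq_top.1 hmax).ge (by simp)
  · rw [le_symm, map_inf] at hbc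
    rw [le_symm, le_symm, ← not_and_or]
    exact hbc

end Spatial

section Nuclei

variable {L : Type v} [Order.Frame L]

/-- The closed nucleus `a ⊔ ·`. -/
def closedNucleus (a : L) : Nucleus L where
  toFun x := a ⊔ x
  map_inf' x y := sup_inf_left a x y
  idempotent' x := by simp
  le_apply' _ := le_sup_right

/-- The open nucleus `a ⇨ ·`. -/
def openNucleus (a : L) : Nucleus L where
  toFun x := a ⇨ x
  map_inf' x y := himp_inf_distrib a x y
  idempotent' x := by simp
  le_apply' _ := le_himp

/-- The double negation nucleus. -/
def doubleNegation (L : Type v) [Order.Frame L] : Nucleus L where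
  toFun x := xᶜᶜ
  map_inf' := compl_compl_inf_distrib
  idempotent' x := by simp
  le_apply' _ := le_compl_compl

theorem closedNucleus_inf_openNucleus (a : L) : closedNucleus a ⊓ openNucleus a = ⊥ := by
  refine Nucleus.ext fun x => ?_
  change (a ⊔ x) ⊓ (a ⇨ x) = x
  rw [inf_sup_right, inf_himp, inf_eq_left.2 le_himp]
  exact sup_eq_right.2 inf_le_right

/-- A meet-prime nucleus sends `⊥` to a meet-prime element. -/
theorem infPrime_apply_bot {P : Nucleus L} (hP : InfPrime P) : InfPrime (P ⊥) := by
  refine ⟨fun hmax => hP.1 (isMax_iff_eq_top.2 ?_), fun a b hab => ?_⟩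
  · exact Nucleus.ext fun x =>
      top_unique ((isMax_iff_eq_top.1 hmax).ge.trans (P.monotone bot_le))
  · rcases hP.2 ((closedNucleus_inf_openNucleus a).le.trans bot_le) with h | h
    · exact Or.inl (le_sup_left.trans (h ⊥))
    · right
      calc
        b ≤ a ⇨ a ⊓ b := by rw [le_himp_iff, inf_comm]
        _ ≤ P (a ⊓ b) := h (a ⊓ b)
        _ ≤ P (P ⊥) := P.monotone hab
        _ = P ⊥ := P.idempotent ⊥

/-- If the frame of nuclei of a nontrivial frame is spatial, then the double negation sublocale of
the frame has a point. -/
theorem exists_infPrime_isRegular [Nontrivial L] (h : IsSpatial (Nucleus L)) :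
    ∃ p : L, InfPrime p ∧ Heyting.IsRegular p := by
  have hne : doubleNegation L ≠ ⊤ := fun heq => by
    have hbot : (⊥ : L)ᶜᶜ = ⊤ := DFunLike.congr_fun heq ⊥
    simp at hbot
  obtain ⟨P, hP, hle⟩ := h.exists_infPrime_ge hne
  -- With `p = P ⊥`, regularity is `pᶜᶜ ≤ P p = p`.
  refine ⟨P ⊥, infPrime_apply_bot hP, le_antisymm ?_ le_compl_compl⟩
  exact (hle (P ⊥)).trans (P.idempotent ⊥).le

end Nuclei

section Splitting

/-- A frame is splitting if each nonzero element lies above two disjoint nonzero elements. -/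
def IsSplitting (L : Type v) [Order.Frame L] : Prop :=
  ∀ a : L, a ≠ ⊥ → ∃ b ≤ a, ∃ c ≤ a, b ≠ ⊥ ∧ c ≠ ⊥ ∧ Disjoint b c

variable {L : Type v} [Order.Frame L]

/-- Two disjoint nonzero elements below `pᶜ` meet in `⊥ ≤ p`, so one lies below both `p` and `pᶜ`.
-/
theorem IsSplitting.not_isRegular (hL : IsSplitting L) {p : L} (hp : InfPrime p) :
    ¬ Heyting.IsRegular p := by
  intro hreg
  have hne : pᶜ ≠ ⊥ := fun h0 => hp.1 (isMax_iff_eq_top.2 (by rw [← hreg.eq, h0, compl_bot]))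
  obtain ⟨b, hb, c, hc, hb0, hc0, hbc⟩ := hL _ hne
  have key {d : L} (hd : d ≤ pᶜ) (hdp : d ≤ p) : d = ⊥ := le_bot_iff.1 (disjoint_compl_right hdp hd)
  rcases hp.2 (hbc.le_bot.trans bot_le) with h | h
  exacts [hb0 (key hb h), hc0 (key hc h)]

theorem IsSplitting.not_isSpatial_nucleus [Nontrivial L] (hL : IsSplitting L) :
    ¬ IsSpatial (Nucleus L) := fun h =>
  let ⟨_, hp, hreg⟩ := exists_infPrime_isRegular h
  hL.not_isRegular hp hreg

namespace Spectrum

theorem bot_notMem (x : Spectrum L) : ⊥ ∉ x.1 := by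
  obtain ⟨i, hi⟩ := x.2.compl_ideal.Nonempty
  exact x.2.compl_ideal.IsLowerSet bot_le hi

/-- Every proper filter extends to a prime filter. -/
theorem exists_ge_of_bot_notMem (F : Order.PFilter L) (hF : ⊥ ∉ F) :
    ∃ x : Spectrum L, F ≤ x.1 := by
  have hdisj : Disjoint (F : Set L) (Order.Ideal.principal (⊥ : L) : Set L) := by
    rw [Set.disjoint_left]
    intro a ha ha'
    exact hF (le_bot_iff.1 (Order.Ideal.mem_principal.1 ha') ▸ ha)
  obtain ⟨J, hJ, -, hFJ⟩ := DistribLattice.prime_ideal_of_disjoint_filter_ideal hdisj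
  exact ⟨⟨hJ.toPrimePair.F, hJ.toPrimePair.F_isPrime⟩, fun a ha => by
    rw [← SetLike.mem_coe, ← hJ.toPrimePair.compl_I_eq_F]
    exact Set.disjoint_left.1 hFJ ha⟩

theorem exists_mem_of_ne_bot {a : L} (ha : a ≠ ⊥) : ∃ x : Spectrum L, a ∈ x.1 := by
  obtain ⟨x, hx⟩ := exists_ge_of_bot_notMem (Order.PFilter.principal a)
    (fun h => ha (le_bot_iff.1 (Order.PFilter.mem_principal.1 h)))
  exact ⟨x, hx (Order.PFilter.mem_principal.2 le_rfl)⟩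

/-- The filter generated by a filter `F` and an element `b`. -/
def adjoin (F : Order.PFilter L) (b : L) : Order.PFilter L :=
  Order.IsPFilter.toPFilter (F := {u : L | b ⇨ u ∈ F}) <| by
    refine .of_def ⟨⊤, ?_⟩ ?_ ?_
    · simp
    · intro u hu v hv
      refine ⟨u ⊓ v, ?_, inf_le_left, inf_le_right⟩
      change b ⇨ u ⊓ v ∈ F
      rw [himp_inf_distrib]
      exact Order.PFilter.inf_mem hu hv
    · exact fun huv hu => Order.PFilter.mem_of_le (himp_le_himp_left huv) hu

theorem mem_adjoin {F : Order.PFilter L} {b u : L} : u ∈ adjoin F b ↔ b ⇨ u ∈ F := Iff.rfl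

theorem compl_mem_of_isMax {y : Spectrum L} (hy : IsMax y) {b : L} (hb : b ∉ y.1) : bᶜ ∈ y.1 := by
  by_contra hbc
  -- If `bᶜ ∉ y`, adjoining `b` to `y` keeps the filter proper, since `b ⇨ ⊥ = bᶜ`.
  obtain ⟨x, hx⟩ := exists_ge_of_bot_notMem (adjoin y.1 b) (by rwa [mem_adjoin, himp_bot])
  have hyx : y ≤ x := fun u hu =>
    hx (mem_adjoin.2 (Order.PFilter.mem_of_le le_himp hu))
  exact hb (hy hyx (hx (mem_adjoin.2 (by simp))))

/-- At a maximal point the sets `η c` form a neighbourhood basis of the patch topology. -/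
theorem exists_eta_subset_of_isMax {y : Spectrum L} (hy : IsMax y) {W : Set (Spectrum L)}
    (hW : IsOpen W) (hyW : y ∈ W) : ∃ c ∈ y.1, eta c ⊆ W := by
  induction hW with
  | basic W hW =>
    obtain ⟨a, b, rfl⟩ := hW
    refine ⟨a ⊓ bᶜ, Order.PFilter.inf_mem hyW.1 (compl_mem_of_isMax hy hyW.2), fun x hx => ?_⟩
    obtain ⟨hax, hbx⟩ := Order.PFilter.inf_mem_iff.1 hx
    refine ⟨hax, fun hb => x.bot_notMem ?_⟩
    rw [← inf_compl_self b]
    exact Order.PFilter.inf_mem hb hbx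
  | univ => exact ⟨⊤, Order.PFilter.top_mem, Set.subset_univ _⟩
  | inter V W _ _ ihV ihW =>
    obtain ⟨c, hc, hcV⟩ := ihV hyW.1
    obtain ⟨d, hd, hdW⟩ := ihW hyW.2
    refine ⟨c ⊓ d, Order.PFilter.inf_mem hc hd, fun x hx => ?_⟩
    obtain ⟨hcx, hdx⟩ := Order.PFilter.inf_mem_iff.1 hx
    exact ⟨hcV hcx, hdW hdx⟩
  | sUnion 𝒲 _ ih =>
    obtain ⟨W, hW, hyW⟩ := hyW
    obtain ⟨c, hc, hcW⟩ := ih W hW hyW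
    exact ⟨c, hc, hcW.trans (Set.subset_sUnion_of_mem hW)⟩

end Spectrum

theorem isOpen_Iic_of_mem_nuclearPoints {y : Spectrum L} (hy : y ∈ nuclearPoints L) :
    IsOpen (Set.Iic y) := by
  have h := (hy.2 Set.univ isClopen_univ).isOpen
  simpa [Set.Iic] using h

theorem IsSplitting.maxPoints_inter_nuclearPoints (hL : IsSplitting L) :
    maxPoints L ∩ nuclearPoints L = ∅ := by
  refine Set.eq_empty_of_forall_notMem fun y ⟨hmax, hnuc⟩ => ?_
  obtain ⟨c, hc, hcy⟩ := Spectrum.exists_eta_subset_of_isMax hmax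
    (isOpen_Iic_of_mem_nuclearPoints hnuc) (le_refl y)
  obtain ⟨a, hac, b, hbc, ha0, hb0, hab⟩ := hL c (fun h => y.bot_notMem (h ▸ hc))
  -- A prime filter containing `d` also contains `c`, hence lies in `η c` and so below `y`.
  have key {d : L} (hdc : d ≤ c) (hd : d ≠ ⊥) : d ∈ y.1 := by
    obtain ⟨x, hx⟩ := Spectrum.exists_mem_of_ne_bot hd
    exact hcy (show c ∈ x.1 from Order.PFilter.mem_of_le hdc hx) hx
  exact y.bot_notMem (hab.eq_bot ▸ Order.PFilter.inf_mem (key hac ha0) (key hbc hb0))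

end Splitting

namespace BinaryTree

open Topology

/-- The child of a node obtained by appending the letter `i`. -/
def child (s : BinaryTree) (i : Bool) : BinaryTree := ⟨s.word ++ [i]⟩

theorem le_child (s : BinaryTree) (i : Bool) : s ≤ s.child i := List.prefix_append s.word [i]

/-- Nodes above distinct children of a node are distinct. -/
theorem eq_of_child_le {s t : BinaryTree} {i j : Bool} (hi : s.child i ≤ t) (hj : s.child j ≤ t) :
    i = j := by
  have h : s.word ++ [i] = s.word ++ [j] :=
    (List.prefix_of_prefix_length_le (show s.word ++ [i] <+: t.word from hi)
      (show s.word ++ [j] <+: t.word from hj) (by simp)).eq_of_length (by simp)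
  simpa using h

/-- The principal upset of a node. -/
def upset (s : BinaryTree) : UpsetFrame BinaryTree :=
  ⟨Set.Ici (WithUpperSet.toUpperSet s), IsUpperSet.isOpen_iff_isUpperSet.2 (isUpperSet_Ici _)⟩

theorem mem_upset {s t : BinaryTree} : WithUpperSet.toUpperSet t ∈ s.upset ↔ s ≤ t := Iff.rfl

theorem upset_ne_bot (s : BinaryTree) : s.upset ≠ ⊥ := fun h =>
  (h ▸ mem_upset.2 le_rfl : WithUpperSet.toUpperSet s ∈ (⊥ : UpsetFrame BinaryTree))

theorem upset_le {s : BinaryTree} {a : UpsetFrame BinaryTree}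
    (hs : WithUpperSet.toUpperSet s ∈ a) : s.upset ≤ a := fun _ ht =>
  IsUpperSet.isOpen_iff_isUpperSet.1 a.isOpen ht hs

theorem isSplitting_upsetFrame : IsSplitting (UpsetFrame BinaryTree) := by
  intro a ha
  obtain ⟨s, hs⟩ := (Opens.ne_bot_iff_nonempty a).1 ha
  have hle (i : Bool) : (child s i).upset ≤ a :=
    upset_le (IsUpperSet.isOpen_iff_isUpperSet.1 a.isOpen (le_child s i) hs)
  refine ⟨_, hle false, _, hle true, upset_ne_bot _, upset_ne_bot _, disjoint_iff_inf_le.2 ?_⟩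
  rintro t ⟨h0, h1⟩
  exact absurd (eq_of_child_le (mem_upset.1 h0) (mem_upset.1 h1)) Bool.false_ne_true

instance : Nontrivial (UpsetFrame BinaryTree) := ⟨⟨_, _, upset_ne_bot ⟨[]⟩⟩⟩

end BinaryTree

end NucleiFrame

theorem theorem3p8 :
    ¬ NucleiFrame.IsSpatial (Nucleus (NucleiFrame.UpsetFrame NucleiFrame.BinaryTree)) ∧
      NucleiFrame.maxPoints (NucleiFrame.UpsetFrame NucleiFrame.BinaryTree) ∩
        NucleiFrame.nuclearPoints (NucleiFrame.UpsetFrame NucleiFrame.BinaryTree) = ∅ :=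
  ⟨NucleiFrame.BinaryTree.isSplitting_upsetFrame.not_isSpatial_nucleus,
    NucleiFrame.BinaryTree.isSplitting_upsetFrame.maxPoints_inter_nuclearPoints⟩
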